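/- Let $N, D \ge 0$ be integers. Identify a polynomial map $P:\mathbb{R}^N\to\mathbb{R}^N$ of degree at most $D$, $P(x)=\sum_{|\alpha|\le D}a_\alpha x^\alpha$ with $a_\alpha\in\mathbb{R}^N$, with the vector of its real coefficients, and equip the (finite-dimensional) space of all such maps with Lebesgue measure. For $k\ge 1$ call $x\in\mathbb{R}^N$ a point of period $k$ of $P$ if $P^k(x)=x$ ($k$ need not be the least period), and call it hyperbolic if the derivative $d_x(P^k)$ has no complex eigenvalue of modulus $1$. Let $\nu_k(P)$ be the number of isolated points of period $k$, that is, isolated points of the set $\{x\in\mathbb{R}^N : P^k(x)=x\}$. Then for Lebesgue-almost every polynomial map $P$ of degree at most $D$ the following hold: 1. for every $k\ge1$, all points of period $k$ of $P$ are hyperbolic, that is, $P$ has only hyperbolic periodic orbits; 2. for every $k\ge1$, $P$ has at most $\max(D,1)^{Nk}$ points of period $k$ (so at most $D^{Nk}$ if $D\ge1$); 3. the number of isolated periodic points grows at most exponentially: there is $C>0$ with $\nu_k(P)\le e^{Ck}$ for all $k\ge1$. -/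

import Mathlib

open MeasureTheory

namespace PolyDyn

/-- The multi-indices `α = (α₁, …, α_N)` of non-negative integers with
`|α| = α₁ + ⋯ + α_N ≤ D`. -/
def multiIndices (N D : ℕ) : Finset (Fin N → ℕ) :=
  (Fintype.piFinset fun _ : Fin N => Finset.range (D + 1)).filter fun α => ∑ i, α i ≤ D

theorem mem_multiIndices {N D : ℕ} {α : Fin N → ℕ} :
    α ∈ multiIndices N D ↔ ∑ i, α i ≤ D := by
  simp only [multiIndices, Finset.mem_filter, Fintype.mem_piFinset, Finset.mem_range,
    and_iff_right_iff_imp]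
  intro h i
  have := Finset.single_le_sum (f := α) (fun _ _ => Nat.zero_le _) (Finset.mem_univ i)
  omega

/-- The space of polynomial maps `ℝ^N → ℝ^N` of degree at most `D`, identified with the
real vector space of their coefficients `a_α ∈ ℝ^N`, `|α| ≤ D`. As a finite product of copies
of `ℝ` it carries Lebesgue measure `volume`. -/
abbrev PolySpace (N D : ℕ) : Type := multiIndices N D → Fin N → ℝ

/-- The polynomial map `x ↦ ∑_{|α| ≤ D} a_α x^α`. -/
noncomputable def polyMap {N D : ℕ} (a : PolySpace N D) (x : Fin N → ℝ) : Fin N → ℝ :=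
  fun i => ∑ α : multiIndices N D, a α i * ∏ j, x j ^ (α : Fin N → ℕ) j

/-- The points of period `k` (not necessarily of least period `k`): the solutions of
`f^k (x) = x`. -/
def periodicPts {X : Type*} (f : X → X) (k : ℕ) : Set X := {x | f^[k] x = x}

/-- The isolated points of period `k`: those with a neighbourhood that contains no other solution
of `f^k (x) = x`. -/
def isolatedPeriodicPts {X : Type*} [TopologicalSpace X] (f : X → X) (k : ℕ) : Set X :=
  {x | x ∈ periodicPts f k ∧ ∃ U : Set X, IsOpen U ∧ U ∩ periodicPts f k = {x}}

/-- The number `P_k(f)` of isolated points of period `k`, possibly infinite. -/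
noncomputable def numIsolated {X : Type*} [TopologicalSpace X] (f : X → X) (k : ℕ) : ℕ∞ :=
  (isolatedPeriodicPts f k).encard

/-- `P_k(f) ≤ exp (C k)` for some `C > 0` and all `k ≥ 1`. -/
def GrowsAtMostExponentially {X : Type*} [TopologicalSpace X] (f : X → X) : Prop :=
  ∃ C : ℝ, 0 < C ∧ ∀ k : ℕ, 0 < k →
    ((numIsolated f k : ℕ∞) : ENNReal) ≤ ENNReal.ofReal (Real.exp (C * k))

/-- The Jacobian matrix of `f^k` at `x`, as a complex matrix. -/
noncomputable def jacobianIterate {N : ℕ} (f : (Fin N → ℝ) → (Fin N → ℝ)) (k : ℕ)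
    (x : Fin N → ℝ) : Matrix (Fin N) (Fin N) ℂ :=
  (LinearMap.toMatrix' (fderiv ℝ f^[k] x : (Fin N → ℝ) →ₗ[ℝ] (Fin N → ℝ))).map
    (fun r : ℝ => (r : ℂ))

/-- A point `x` of period `k` is hyperbolic if the linearization of `f^k` at `x` has no complex
eigenvalue of modulus one. (An eigenvalue zero is allowed: `f` need not be invertible.) -/
def IsHyperbolicAt {N : ℕ} (f : (Fin N → ℝ) → (Fin N → ℝ)) (k : ℕ) (x : Fin N → ℝ) : Prop :=
  DifferentiableAt ℝ f^[k] x ∧ ∀ z ∈ spectrum ℂ (jacobianIterate f k x), ‖z‖ ≠ 1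

/-- All periodic orbits of `f`, of all periods, are hyperbolic. -/
def OnlyHyperbolicPeriodicOrbits {N : ℕ} (f : (Fin N → ℝ) → (Fin N → ℝ)) : Prop :=
  ∀ k : ℕ, 0 < k → ∀ x ∈ periodicPts f k, IsHyperbolicAt f k x

end PolyDyn

/-! For each `k` it suffices to find nonzero polynomials in the coefficients of the map, countably
many in all, whose nonvanishing forces the claim: a nonzero polynomial vanishes only on a null set
(`ae_eval_ne_zero`). They come from one model map, `x_i ↦ 2 x_i ^ D`. Its period-`k` equations are
`f (x_i) = 0` for a single univariate `f` of degree `d = max D 1 ^ k`, so monomials with all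
exponents below `d` span everything modulo these equations, with control of degrees. In bounded
degree such spanning is the nonvanishing of a determinant, hence persists for generic coefficients
(`exists_ne_zero_forall_mem_of_liftable`). The quotient then has dimension at most `d ^ N`, which
bounds the number of real zeros (`encard_zeros_le`). For hyperbolicity, `det (1 - J ⊗ J)` vanishes
whenever the real matrix `J` has an eigenvalue on the unit circle. For the model this determinant
and the period equations generate the unit ideal; the same determinant argument spreads this to
generic coefficients (`exists_ne_zero_forall_one_mem`). -/

namespace PolyDyn

open MvPolynomial

/-! ### Generic persistence of spanning statements in bounded degree. -/

section Generic

variable {σ τ : Type*}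

/-- The polynomials that extend from the parameter `a₀` to a polynomial family of degree at most
`m` whose value at each parameter `a` lies in `Q a`. -/
noncomputable def liftable (Q : (σ → ℝ) → Submodule ℝ (MvPolynomial τ ℝ)) (a₀ : σ → ℝ) (m : ℕ) :
    Submodule ℝ (MvPolynomial τ ℝ) where
  carrier := {p | ∃ w : MvPolynomial τ (MvPolynomial σ ℝ), w.totalDegree ≤ m ∧
    (∀ a, map (eval a) w ∈ Q a) ∧ map (eval a₀) w = p}
  zero_mem' := ⟨0, by simp, by simp, by simp⟩
  add_mem' := by
    rintro _ _ ⟨v, hv, hvQ, rfl⟩ ⟨w, hw, hwQ, rfl⟩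
    refine ⟨v + w, (totalDegree_add v w).trans (max_le hv hw), fun a => ?_, by simp⟩
    rw [map_add]
    exact add_mem (hvQ a) (hwQ a)
  smul_mem' := by
    rintro c _ ⟨w, hw, hwQ, rfl⟩
    have h (a : σ → ℝ) : map (eval a) (C (C c) * w) = c • map (eval a) w := by
      rw [map_mul, map_C, eval_C, smul_eq_C_mul]
    refine ⟨C (C c) * w, (totalDegree_mul _ _).trans (by simpa using hw), fun a => ?_, h a₀⟩
    rw [h]
    exact Submodule.smul_mem _ _ (hwQ a)

/-- `S` is the determinant of the coefficient matrix of lifts of the monomials of degree at most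
`m`. At `a₀` this matrix is the identity, so `S ≠ 0`; where `S` does not vanish, inverting it
recovers every monomial from elements of `Q a`. -/
theorem exists_ne_zero_forall_mem_of_liftable [Finite τ]
    {Q : (σ → ℝ) → Submodule ℝ (MvPolynomial τ ℝ)} {a₀ : σ → ℝ} {m : ℕ}
    (h : ∀ s : τ →₀ ℕ, s.degree ≤ m → monomial s (1 : ℝ) ∈ liftable Q a₀ m) :
    ∃ S : MvPolynomial σ ℝ, S ≠ 0 ∧ ∀ a, eval a S ≠ 0 →
      ∀ p : MvPolynomial τ ℝ, p.totalDegree ≤ m → p ∈ Q a := by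
  classical
  let ι := {s : τ →₀ ℕ // s.degree ≤ m}
  have : Finite ι := (Finsupp.finite_of_degree_le (σ := τ) m).to_subtype
  have := Fintype.ofFinite ι
  have h' (s : ι) := h s.1 s.2
  choose w hdeg hQ hw using h'
  let M : Matrix ι ι (MvPolynomial σ ℝ) := Matrix.of fun s t => coeff t.1 (w s)
  have hM (a : σ → ℝ) : eval a M.det = (M.map (eval a)).det := RingHom.map_det _ _
  have hM₀ : M.map (eval a₀) = 1 := by
    ext s t
    have := congrArg (coeff t.1) (hw s)
    rw [coeff_map, coeff_monomial] at this
    simp only [M, this, Matrix.one_apply, Matrix.map_apply, Matrix.of_apply]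
    exact if_congr Subtype.ext_iff.symm rfl rfl
  refine ⟨M.det, fun h0 => ?_, fun a ha p hp => ?_⟩
  · have := hM a₀
    simp [h0, hM₀] at this
  · set A := M.map (eval a) with hA
    have hdet : IsUnit A.det := by
      rw [← hM]
      exact ha.isUnit
    have hmon (u : ι) : monomial u.1 (1 : ℝ) ∈ Q a := by
      have key : monomial u.1 (1 : ℝ) = ∑ s, A⁻¹ u s • map (eval a) (w s) := by
        ext t
        rw [coeff_sum]
        simp only [coeff_smul, coeff_map, smul_eq_mul]
        by_cases ht : t.degree ≤ m
        · have := congrFun (congrFun (Matrix.nonsing_inv_mul A hdet) u) ⟨t, ht⟩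
          rw [Matrix.mul_apply] at this
          rw [coeff_monomial]
          refine Eq.trans ?_ this.symm
          rw [Matrix.one_apply]
          exact if_congr (Subtype.ext_iff (a1 := u) (a2 := ⟨t, ht⟩)).symm rfl rfl
        · have hc (s : ι) : coeff t (w s) = 0 := by
            refine coeff_eq_zero_of_totalDegree_lt (lt_of_le_of_lt (hdeg s) ?_)
            have := not_le.1 ht
            rwa [Finsupp.degree_apply] at this
          rw [coeff_monomial, if_neg]
          · simp [hc]
          · rintro rfl
            exact ht u.2
      rw [key]
      exact Submodule.sum_mem _ fun s _ => Submodule.smul_mem _ _ (hQ s a)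
    rw [p.as_sum]
    refine Submodule.sum_mem _ fun s hs => ?_
    have hs' : s.degree ≤ m := by
      refine le_trans ?_ ((le_totalDegree hs).trans hp)
      rw [Finsupp.degree_apply]; rfl
    have := Submodule.smul_mem _ (coeff s p) (hmon ⟨s, hs'⟩)
    simpa [smul_monomial] using this

/-- The span of the monomials in which every exponent is less than `d`. -/
noncomputable def reduced (τ : Type*) (d : ℕ) : Submodule ℝ (MvPolynomial τ ℝ) :=
  Submodule.span ℝ {p | ∃ s : τ →₀ ℕ, (∀ i, s i < d) ∧ p = monomial s 1}

/-- Division by the `f (X i)`: a factor `X i ^ natDegree f` is traded for lower powers, so the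
degree never exceeds `m`. This bound is what makes the expression liftable. -/
theorem monomial_mem_span_sup_reduced {f : Polynomial ℝ} (hf : f ≠ 0) {m : ℕ} (s : τ →₀ ℕ)
    (hs : s.degree ≤ m) :
    monomial s (1 : ℝ) ∈ Submodule.span ℝ {p | ∃ (β : τ →₀ ℕ) (i : τ),
      β.degree + f.natDegree ≤ m ∧ p = monomial β 1 * Polynomial.aeval (X i) f} ⊔
      reduced τ f.natDegree := by
  classical
  induction hn : s.degree using Nat.strong_induction_on generalizing s with
  | _ n ih =>
  set T := Submodule.span ℝ {p | ∃ (β : τ →₀ ℕ) (i : τ),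
      β.degree + f.natDegree ≤ m ∧ p = monomial β 1 * Polynomial.aeval (X i) f} ⊔
      reduced τ f.natDegree
  by_cases hred : ∀ i, s i < f.natDegree
  · exact Submodule.mem_sup_right (Submodule.subset_span ⟨s, hred, rfl⟩)
  push Not at hred
  obtain ⟨i, hi⟩ := hred
  obtain ⟨β, rfl⟩ : ∃ β, s = β + Finsupp.single i f.natDegree :=
    ⟨s - Finsupp.single i f.natDegree, (tsub_add_cancel_of_le (by simpa using hi)).symm⟩
  have hdeg (e : ℕ) : (β + Finsupp.single i e).degree = β.degree + e := by simp
  rw [hdeg] at hs hn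
  have hexp : monomial β (1 : ℝ) * Polynomial.aeval (X i) f =
      ∑ e ∈ Finset.range f.natDegree, f.coeff e • monomial (β + Finsupp.single i e) (1 : ℝ) +
        f.leadingCoeff • monomial (β + Finsupp.single i f.natDegree) (1 : ℝ) := by
    rw [Polynomial.aeval_eq_sum_range, Finset.mul_sum, Finset.sum_range_succ]
    congr 1
    · refine Finset.sum_congr rfl fun e _ => ?_
      rw [mul_smul_comm, X_pow_eq_monomial, monomial_mul, one_mul]
    · rw [mul_smul_comm, X_pow_eq_monomial, monomial_mul, one_mul, Polynomial.leadingCoeff]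
  have hlc : f.leadingCoeff ≠ 0 := Polynomial.leadingCoeff_ne_zero.2 hf
  have h1 : monomial β (1 : ℝ) * Polynomial.aeval (X i) f ∈ T :=
    Submodule.mem_sup_left (Submodule.subset_span ⟨β, i, hs, rfl⟩)
  have h2 : ∑ e ∈ Finset.range f.natDegree,
      f.coeff e • monomial (β + Finsupp.single i e) (1 : ℝ) ∈ T := by
    refine Submodule.sum_mem _ fun e he => Submodule.smul_mem _ _ ?_
    have := Finset.mem_range.1 he
    exact ih (β.degree + e) (by omega) _ (by rw [hdeg]; omega) (hdeg e)
  have h3 := sub_mem h1 h2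
  rw [hexp, add_sub_cancel_left] at h3
  simpa [smul_smul, hlc, smul_monomial] using Submodule.smul_mem _ f.leadingCoeff⁻¹ h3

variable {F : τ → MvPolynomial τ (MvPolynomial σ ℝ)} {a₀ : σ → ℝ} {f : Polynomial ℝ}

theorem monomial_mul_mem_liftable {Q : (σ → ℝ) → Submodule ℝ (MvPolynomial τ ℝ)} {m : ℕ}
    (hFd : ∀ i, (F i).totalDegree ≤ f.natDegree)
    (hF : ∀ i, map (eval a₀) (F i) = Polynomial.aeval (X i) f)
    (hQ : ∀ a p i, p * map (eval a) (F i) ∈ Q a) :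
    Submodule.span ℝ {p | ∃ (β : τ →₀ ℕ) (i : τ),
      β.degree + f.natDegree ≤ m ∧ p = monomial β 1 * Polynomial.aeval (X i) f} ≤
      liftable Q a₀ m := by
  rw [Submodule.span_le]
  rintro _ ⟨β, i, hβ, rfl⟩
  refine ⟨monomial β 1 * F i, ?_, fun a => ?_, by rw [map_mul, hF, map_monomial, map_one]⟩
  · refine (totalDegree_mul _ _).trans (le_trans (add_le_add ?_ (hFd i)) hβ)
    refine (totalDegree_monomial_le _ _).trans (le_of_eq ?_)
    rw [Finsupp.degree_apply]; rfl
  · rw [map_mul]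
    exact hQ a _ i

/-- For generic parameters the reduced monomials span the polynomials of bounded degree modulo
the ideal generated by the `F i`. -/
theorem exists_ne_zero_forall_mem_sup_reduced [Finite τ] (hf : f ≠ 0)
    (hFd : ∀ i, (F i).totalDegree ≤ f.natDegree)
    (hF : ∀ i, map (eval a₀) (F i) = Polynomial.aeval (X i) f) (m : ℕ) :
    ∃ S : MvPolynomial σ ℝ, S ≠ 0 ∧ ∀ a, eval a S ≠ 0 →
      ∀ p : MvPolynomial τ ℝ, p.totalDegree ≤ m →
        p ∈ (Ideal.span (Set.range fun i => map (eval a) (F i))).restrictScalars ℝ ⊔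
          reduced τ f.natDegree := by
  cases nonempty_fintype τ
  -- The degree bound is enlarged so that every reduced monomial satisfies it.
  have hlift (s : τ →₀ ℕ) (hs : s.degree ≤ m + ∑ _i : τ, f.natDegree) :
      monomial s (1 : ℝ) ∈ liftable (fun a =>
        (Ideal.span (Set.range fun i => map (eval a) (F i))).restrictScalars ℝ ⊔
          reduced τ f.natDegree) a₀ (m + ∑ _i : τ, f.natDegree) := by
    refine (sup_le ?_ ?_ : _ ≤ liftable _ _ _) (monomial_mem_span_sup_reduced hf s hs)
    · refine monomial_mul_mem_liftable hFd hF fun a p i => Submodule.mem_sup_left ?_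
      exact Ideal.mul_mem_left _ _ (Ideal.subset_span ⟨i, rfl⟩)
    · rw [reduced, Submodule.span_le]
      rintro _ ⟨t, ht, rfl⟩
      refine ⟨monomial t 1, ?_, fun a => Submodule.mem_sup_right ?_, by simp⟩
      · refine (totalDegree_monomial_le _ _).trans (le_trans ?_ (Nat.le_add_left _ _))
        rw [Finsupp.sum_fintype _ _ (by simp)]
        exact Finset.sum_le_sum fun i _ => (ht i).le
      · rw [map_monomial, map_one]
        exact Submodule.subset_span ⟨t, ht, rfl⟩
  obtain ⟨S, hS, h⟩ := exists_ne_zero_forall_mem_of_liftable hlift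
  exact ⟨S, hS, fun a ha p hp => h a ha p (hp.trans (Nat.le_add_right _ _))⟩

theorem map_eval_map_C (a : σ → ℝ) (p : MvPolynomial τ ℝ) : map (eval a) (map C p) = p := by
  rw [map_map]
  convert map_id p
  ext x
  simp

theorem totalDegree_map_C_le (p : MvPolynomial τ ℝ) :
    (map (C : ℝ →+* MvPolynomial σ ℝ) p).totalDegree ≤ p.totalDegree :=
  Finset.sup_mono (support_map_subset _ _)

/-- If `g` generates the unit ideal together with the `F i` at the parameter `a₀`, then it does so
for generic parameters. -/
theorem exists_ne_zero_forall_one_mem [Finite τ] (hf : f ≠ 0)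
    (hFd : ∀ i, (F i).totalDegree ≤ f.natDegree)
    (hF : ∀ i, map (eval a₀) (F i) = Polynomial.aeval (X i) f)
    (g : MvPolynomial τ (MvPolynomial σ ℝ))
    (hg : 1 ∈ Ideal.span (Set.range fun i => map (eval a₀) (F i)) ⊔
      Ideal.span {map (eval a₀) g}) :
    ∃ S : MvPolynomial σ ℝ, S ≠ 0 ∧ ∀ a, eval a S ≠ 0 →
      1 ∈ Ideal.span (Set.range fun i => map (eval a) (F i)) ⊔ Ideal.span {map (eval a) g} := by
  cases nonempty_fintype τ
  obtain ⟨y, hy, z, hz, hyz⟩ := Submodule.mem_sup.1 hg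
  obtain ⟨c, rfl⟩ := Ideal.mem_span_range_iff_exists_fun.1 hy
  obtain ⟨b, rfl⟩ := Ideal.mem_span_singleton'.1 hz
  -- Room for a reduced monomial times the certificate that expresses `1` at `a₀`.
  set m := ∑ _i : τ, f.natDegree + (∑ i, (c i).totalDegree + b.totalDegree +
    f.natDegree + g.totalDegree) with hm
  have hlift (s : τ →₀ ℕ) (hs : s.degree ≤ m) :
      monomial s (1 : ℝ) ∈ liftable (fun a =>
        (Ideal.span (Set.range fun i => map (eval a) (F i)) ⊔
          Ideal.span {map (eval a) g}).restrictScalars ℝ) a₀ m := by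
    have hQF (a : σ → ℝ) (p : MvPolynomial τ ℝ) (i : τ) : p * map (eval a) (F i) ∈
        Ideal.span (Set.range fun i => map (eval a) (F i)) ⊔ Ideal.span {map (eval a) g} :=
      Ideal.mul_mem_left _ _ (Ideal.mem_sup_left (Ideal.subset_span ⟨i, rfl⟩))
    have hQg (a : σ → ℝ) (p : MvPolynomial τ ℝ) : p * map (eval a) g ∈
        Ideal.span (Set.range fun i => map (eval a) (F i)) ⊔ Ideal.span {map (eval a) g} :=
      Ideal.mul_mem_left _ _ (Ideal.mem_sup_right (Ideal.subset_span rfl))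
    refine (sup_le ?_ ?_ : _ ≤ liftable _ _ _) (monomial_mem_span_sup_reduced hf s hs)
    · exact monomial_mul_mem_liftable hFd hF hQF
    · rw [reduced, Submodule.span_le]
      rintro _ ⟨t, ht, rfl⟩
      have htd : (monomial t (1 : MvPolynomial σ ℝ)).totalDegree ≤ ∑ _i : τ, f.natDegree := by
        refine (totalDegree_monomial_le _ _).trans ?_
        rw [Finsupp.sum_fintype _ _ (by simp)]
        exact Finset.sum_le_sum fun i _ => (ht i).le
      -- The certificate with its multipliers `c i`, `b` frozen lies in the ideal at every parameter
      -- and equals `1` at `a₀`, so this product lifts the monomial.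
      refine ⟨monomial t 1 * (∑ i, map C (c i) * F i + map C b * g), ?_, fun a => ?_, ?_⟩
      · refine (totalDegree_mul _ _).trans (add_le_add htd ?_)
        refine (totalDegree_add _ _).trans (max_le ?_ ?_)
        · refine totalDegree_finsetSum_le fun i hi => (totalDegree_mul _ _).trans ?_
          have h1 := totalDegree_map_C_le (σ := σ) (c i)
          have h2 := Finset.single_le_sum (f := fun i => (c i).totalDegree)
            (fun _ _ => Nat.zero_le _) hi
          have h3 := hFd i
          omega
        · refine (totalDegree_mul _ _).trans ?_
          have h1 := totalDegree_map_C_le (σ := σ) b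
          omega
      · simp only [map_mul, map_add, map_sum, map_eval_map_C]
        rw [Submodule.restrictScalars_mem]
        exact Ideal.mul_mem_left _ _
          (Ideal.add_mem _ (Ideal.sum_mem _ fun i _ => hQF a (c i) i) (hQg a b))
      · simp only [map_mul, map_add, map_sum, map_eval_map_C]
        rw [hyz, map_monomial, map_one, mul_one]
  obtain ⟨S, hS, h⟩ := exists_ne_zero_forall_mem_of_liftable hlift
  exact ⟨S, hS, fun a ha => h a ha 1 (by simp)⟩

end Generic

/-- If the reduced monomials span all polynomials modulo an ideal, the ideal has at most
`d ^ N` common real zeros. -/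
theorem encard_zeros_le {N d : ℕ} {I : Ideal (MvPolynomial (Fin N) ℝ)}
    (hI : ∀ p : MvPolynomial (Fin N) ℝ, p ∈ I.restrictScalars ℝ ⊔ reduced (Fin N) d)
    {Z : Set (Fin N → ℝ)} (hZ : ∀ x ∈ Z, ∀ p ∈ I, eval x p = 0) :
    Z.encard ≤ ((d ^ N : ℕ) : ℕ∞) := by
  classical
  let v : Z → (Fin N → Fin d) → ℝ := fun x γ => ∏ j, x.1 j ^ (γ j : ℕ)
  have hinj : Function.Injective
      (fun x : Z => ((eval x.1 : MvPolynomial (Fin N) ℝ →+* ℝ) : MvPolynomial (Fin N) ℝ →* ℝ)) := by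
    intro x y hxy
    ext j
    simpa using DFunLike.congr_fun hxy (X j)
  -- Dedekind: evaluations at distinct points are linearly independent. A relation among their
  -- values on reduced monomials holds on all polynomials, since evaluations at `Z` kill `I`.
  have hli := (linearIndependent_monoidHom (MvPolynomial (Fin N) ℝ) ℝ).comp _ hinj
  have hv : LinearIndependent ℝ v := by
    rw [linearIndependent_iff'] at hli ⊢
    intro s c hc x hx
    refine hli s c ?_ x hx
    let φ : MvPolynomial (Fin N) ℝ →ₗ[ℝ] ℝ := ∑ y ∈ s, c y • (aeval y.1).toLinearMap
    have hφ (p : MvPolynomial (Fin N) ℝ) : φ p = ∑ y ∈ s, c y * eval y.1 p := by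
      simp [φ, LinearMap.sum_apply, aeval_eq_eval]
    suffices h : ∀ p, φ p = 0 by
      funext p
      have := h p
      rw [hφ] at this
      simpa using this
    intro p
    have hle : I.restrictScalars ℝ ⊔ reduced (Fin N) d ≤ LinearMap.ker φ := by
      refine sup_le (fun q hq => ?_) ?_
      · rw [LinearMap.mem_ker, hφ]
        exact Finset.sum_eq_zero fun y _ => by rw [hZ y.1 y.2 q hq, mul_zero]
      · rw [reduced, Submodule.span_le]
        rintro _ ⟨t, ht, rfl⟩
        rw [SetLike.mem_coe, LinearMap.mem_ker, hφ]
        have := congrFun hc fun j => ⟨t j, ht j⟩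
        simpa [v, eval_monomial, Finsupp.prod_fintype] using this
    exact hle (hI p)
  have : Finite Z := hv.finite
  have := Fintype.ofFinite Z
  have h := hv.fintype_card_le_finrank
  rw [Module.finrank_fintype_fun_eq_card, Fintype.card_fun, Fintype.card_fin, Fintype.card_fin] at h
  rw [Set.encard_eq_coe_toFinset_card, Set.toFinset_card]
  exact_mod_cast h

end PolyDyn

namespace PolyDyn

open MvPolynomial

/-! ### Zero sets of nonzero polynomials are null. -/

section Null

theorem _root_.MvPolynomial.IsHomogeneous.eval_smul_real {σ : Type*} {φ : MvPolynomial σ ℝ} {k : ℕ}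
    (hφ : φ.IsHomogeneous k) (t : ℝ) (y : σ → ℝ) : eval (t • y) φ = t ^ k * eval y φ := by
  rw [eval_eq, eval_eq, Finset.mul_sum]
  refine Finset.sum_congr rfl fun s hs => ?_
  have h : s.degree = k := by
    have := hφ (mem_support_iff.1 hs)
    rw [Finsupp.degree_eq_weight_one]
    exact this
  rw [← h, Finsupp.degree_apply, ← Finset.prod_pow_eq_pow_sum]
  simp only [Pi.smul_apply, smul_eq_mul, mul_pow, Finset.prod_mul_distrib]
  ring

/-- A nonzero polynomial does not vanish identically on any line in a suitable direction. -/
theorem exists_direction {σ : Type*} {S : MvPolynomial σ ℝ} (hS : S ≠ 0) :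
    ∃ v : σ → ℝ, ∀ a : σ → ℝ, {t : ℝ | eval (a + t • v) S = 0}.Finite := by
  set n := S.totalDegree
  have hn : homogeneousComponent n S ≠ 0 := by
    intro h
    obtain ⟨s, hs, hsn⟩ : ∃ s ∈ S.support, (s.sum fun _ e => e) = n := by
      obtain ⟨s, hs, h⟩ := Finset.exists_mem_eq_sup S.support (support_nonempty.2 hS)
        (fun s => s.sum fun _ e => e)
      exact ⟨s, hs, h.symm⟩
    have := congrArg (coeff s) h
    rw [coeff_homogeneousComponent, if_pos (by rw [← hsn, Finsupp.degree_apply]; rfl)] at this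
    exact mem_support_iff.1 hs this
  obtain ⟨v, hv⟩ : ∃ v, eval v (homogeneousComponent n S) ≠ 0 := by
    by_contra! h
    exact hn (MvPolynomial.funext fun v => by simpa using h v)
  refine ⟨v, fun a => ?_⟩
  -- The reversal `s ^ n * S (a + v / s)`; its value at `0` is the top homogeneous part of `S` at
  -- `v`, which is nonzero.
  let q : Polynomial ℝ := ∑ k ∈ Finset.range (n + 1), Polynomial.X ^ (n - k) *
    aeval (fun i => Polynomial.C (a i) * Polynomial.X + Polynomial.C (v i))
      (homogeneousComponent k S)
  have hq (s : ℝ) : q.eval s = ∑ k ∈ Finset.range (n + 1), s ^ (n - k) *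
      eval (s • a + v) (homogeneousComponent k S) := by
    simp only [q, Polynomial.eval_finsetSum, Polynomial.eval_mul, Polynomial.eval_pow,
      Polynomial.eval_X]
    refine Finset.sum_congr rfl fun k _ => congrArg _ ?_
    rw [← Polynomial.coe_evalRingHom, aeval_def, hom_eval₂, eval, coe_eval₂Hom]
    congr 1
    · ext r
      simp
    · funext i
      simp only [Polynomial.coe_evalRingHom, Polynomial.eval_add, Polynomial.eval_mul,
        Polynomial.eval_C, Polynomial.eval_X, Pi.add_apply, Pi.smul_apply, smul_eq_mul, mul_comm]
  have hq0 : q ≠ 0 := by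
    intro h
    have := hq 0
    rw [h, Finset.sum_range_succ, Finset.sum_eq_zero] at this
    · simp at this
      exact hv this.symm
    · intro k hk
      rw [zero_pow (by have := Finset.mem_range.1 hk; omega), zero_mul]
  have hmul (t : ℝ) (ht : t ≠ 0) : eval (a + t • v) S = t ^ n * q.eval t⁻¹ := by
    rw [hq, Finset.mul_sum]
    conv_lhs => rw [← sum_homogeneousComponent S, map_sum]
    refine Finset.sum_congr rfl fun k hk => ?_
    have hk' : k ≤ n := Nat.lt_succ_iff.1 (Finset.mem_range.1 hk)
    have h1 : a + t • v = t • (t⁻¹ • a + v) := by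
      rw [smul_add, smul_smul, mul_inv_cancel₀ ht, one_smul]
    rw [h1]
    rw [(homogeneousComponent_isHomogeneous k S).eval_smul_real, ← mul_assoc]
    congr 1
    rw [inv_pow, ← div_eq_mul_inv, eq_div_iff (pow_ne_zero _ ht), ← pow_add,
      Nat.add_sub_cancel' hk']
  refine (((q.roots.toFinset.finite_toSet).preimage inv_injective.injOn).insert 0).subset ?_
  intro t ht
  by_cases h0 : t = 0
  · exact Or.inl h0
  · right
    have := hmul t h0
    have ht' : eval (a + t • v) S = 0 := ht
    rw [ht'] at this
    have h3 := (mul_eq_zero.1 this.symm).resolve_left (pow_ne_zero _ h0)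
    simpa [hq0] using h3

theorem ae_eval_ne_zero {E σ : Type*} [Finite σ] [NormedAddCommGroup E] [NormedSpace ℝ E]
    [FiniteDimensional ℝ E] [MeasurableSpace E] [BorelSpace E] (μ : Measure E)
    [μ.IsAddHaarMeasure] (ℓ : E →ₗ[ℝ] σ → ℝ) (hℓ : Function.Surjective ℓ)
    {S : MvPolynomial σ ℝ} (hS : S ≠ 0) : ∀ᵐ a ∂μ, eval (ℓ a) S ≠ 0 := by
  obtain ⟨v, hv⟩ := exists_direction hS
  obtain ⟨w, rfl⟩ := hℓ v
  have hcont : Continuous fun a => eval (ℓ a) S :=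
    (MvPolynomial.continuous_eval S).comp ℓ.continuous_of_finiteDimensional
  refine ae_mem_of_ae_add_linearMap_mem (LinearMap.toSpanSingleton ℝ E w) volume μ
    (s := {a | eval (ℓ a) S ≠ 0}) (isOpen_ne_fun hcont continuous_const).measurableSet fun a => ?_
  have := (hv (ℓ a)).measure_zero volume
  rw [ae_iff]
  simpa using this

end Null

/-! ### Iterates, Jacobians and the resonance determinant. -/

section Iterate

variable {τ R R' : Type*} [CommRing R] [CommRing R']

/-- The components of the `k`-th iterate of a polynomial map. -/
noncomputable def polyIter (P : τ → MvPolynomial τ R) : ℕ → τ → MvPolynomial τ R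
  | 0 => X
  | k + 1 => fun i => bind₁ P (polyIter P k i)

theorem map_polyIter (φ : R →+* R') (P : τ → MvPolynomial τ R) (k : ℕ) (i : τ) :
    map φ (polyIter P k i) = polyIter (fun j => map φ (P j)) k i := by
  induction k with
  | zero => simp [polyIter]
  | succ k ih => simp only [polyIter]; rw [map_bind₁, ih]

theorem eval_polyIter (P : τ → MvPolynomial τ R) (k : ℕ) (x : τ → R) :
    (fun i => eval x (polyIter P k i)) = (fun x i => eval x (P i))^[k] x := by
  induction k generalizing x with
  | zero => simp [polyIter]
  | succ k ih =>
    rw [Function.iterate_succ_apply, ← ih]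
    funext i
    simp only [polyIter]
    rw [← coe_aeval_eq_eval, RingHom.coe_coe, aeval_bind₁]
    rfl

theorem totalDegree_bind₁_le {n : ℕ} {P : τ → MvPolynomial τ R} (hP : ∀ i, (P i).totalDegree ≤ n)
    (p : MvPolynomial τ R) : (bind₁ P p).totalDegree ≤ p.totalDegree * n := by
  conv_lhs => rw [p.as_sum, map_sum]
  refine totalDegree_finsetSum_le fun s hs => ?_
  rw [bind₁_monomial]
  refine (totalDegree_mul _ _).trans ?_
  rw [totalDegree_C, zero_add]
  refine (totalDegree_finsetProd _ _).trans ?_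
  refine le_trans ?_ (Nat.mul_le_mul_right n (le_totalDegree hs))
  rw [Finsupp.sum, Finset.sum_mul]
  exact Finset.sum_le_sum fun i _ => (totalDegree_pow _ _).trans (Nat.mul_le_mul_left _ (hP i))

theorem totalDegree_polyIter_le {n : ℕ} {P : τ → MvPolynomial τ R}
    (hP : ∀ i, (P i).totalDegree ≤ n) (k : ℕ) (i : τ) :
    (polyIter P k i).totalDegree ≤ n ^ k := by
  induction k with
  | zero =>
    rw [polyIter, pow_zero]
    refine (totalDegree_monomial_le _ _).trans ?_
    simp
  | succ k ih =>
    rw [pow_succ]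
    exact (totalDegree_bind₁_le hP _).trans (Nat.mul_le_mul_right n ih)

variable [Fintype τ] [DecidableEq τ]

/-- The Jacobian matrix of a polynomial map. -/
noncomputable def jacobian (Q : τ → MvPolynomial τ R) : Matrix τ τ (MvPolynomial τ R) :=
  Matrix.of fun i j => pderiv j (Q i)

open Kronecker in
/-- The determinant of `1 - J ⊗ J`, where `J` is the Jacobian matrix. It vanishes where `J` has two
eigenvalues with product one. -/
noncomputable def resonance (Q : τ → MvPolynomial τ R) : MvPolynomial τ R :=
  (1 - jacobian Q ⊗ₖ jacobian Q).det

open Kronecker in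
theorem ringHom_det_one_sub_kronecker {A B : Type*} [CommRing A] [CommRing B] (φ : A →+* B)
    (J : Matrix τ τ A) : φ (1 - J ⊗ₖ J).det = (1 - J.map φ ⊗ₖ J.map φ).det := by
  rw [RingHom.map_det]
  congr 1
  ext ⟨i, i'⟩ ⟨j, j'⟩
  by_cases h : (i, i') = (j, j')
  · simp [h]
  · simp [h]

theorem map_resonance (φ : R →+* R') (Q : τ → MvPolynomial τ R) :
    map φ (resonance Q) = resonance fun i => map φ (Q i) := by
  rw [resonance, ringHom_det_one_sub_kronecker, resonance]
  have : (jacobian Q).map (map φ) = jacobian fun i => map φ (Q i) := by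
    ext1 i j
    simp [jacobian, pderiv_map]
  rw [this]

open Kronecker in
-- If `J w = z w`, then `J` being real gives the conjugate eigenpair, and `w ⊗ star w` is fixed by
-- `J ⊗ J` because `z * star z = 1`.
theorem det_one_sub_kronecker_eq_zero {J : Matrix τ τ ℝ} {z : ℂ} (hz : ‖z‖ = 1)
    (h : z ∈ spectrum ℂ (J.map (fun r : ℝ => (r : ℂ)))) : (1 - J ⊗ₖ J).det = 0 := by
  have hdet : (algebraMap ℂ _ z - J.map (fun r : ℝ => (r : ℂ))).det = 0 := by
    rw [spectrum.mem_iff, Matrix.isUnit_iff_isUnit_det, isUnit_iff_ne_zero, not_not] at h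
    exact h
  obtain ⟨w, hw, hJw⟩ := Matrix.exists_mulVec_eq_zero_iff.2 hdet
  have hJ (i : τ) : ∑ j, (J i j : ℂ) * w j = z * w i := by
    have := congrFun hJw i
    rw [Matrix.sub_mulVec, Algebra.algebraMap_eq_smul_one, Matrix.smul_mulVec, Matrix.one_mulVec]
      at this
    simp only [Pi.sub_apply, Pi.smul_apply, smul_eq_mul, Pi.zero_apply, sub_eq_zero] at this
    exact this.symm
  have hJ' (i : τ) : ∑ j, (J i j : ℂ) * star (w j) = star z * star (w i) := by
    have := congrArg star (hJ i)
    simpa [mul_comm] using this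
  have hzz : z * star z = 1 := by
    have := Complex.mul_conj z
    rw [Complex.normSq_eq_norm_sq, hz] at this
    simpa using this
  have key : (1 - J.map Complex.ofRealHom ⊗ₖ J.map Complex.ofRealHom).det = 0 := by
    rw [← Matrix.exists_mulVec_eq_zero_iff]
    refine ⟨fun p => w p.1 * star (w p.2), fun h0 => hw ?_, ?_⟩
    · funext i
      have := congrFun h0 (i, i)
      simpa using this
    · funext ⟨i, i'⟩
      rw [Matrix.sub_mulVec, Matrix.one_mulVec]
      simp only [Pi.sub_apply, Pi.zero_apply, sub_eq_zero, Matrix.mulVec, dotProduct,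
        Fintype.sum_prod_type, Matrix.kroneckerMap_apply, Matrix.map_apply,
        Complex.ofRealHom_eq_coe]
      calc w i * star (w i') = (z * w i) * (star z * star (w i')) := by
            linear_combination (-(w i * star (w i'))) * hzz
        _ = _ := by
            rw [← hJ, ← hJ', Finset.sum_mul_sum]
            exact Finset.sum_congr rfl fun j _ => Finset.sum_congr rfl fun j' _ => by ring
  rw [← ringHom_det_one_sub_kronecker] at key
  simpa using key

theorem hasFDerivAt_eval (p : MvPolynomial τ ℝ) (x : τ → ℝ) :
    HasFDerivAt (fun y => eval y p)
      (∑ j, eval x (pderiv j p) • ContinuousLinearMap.proj (R := ℝ) (φ := fun _ : τ => ℝ) j) x := by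
  induction p using MvPolynomial.induction_on with
  | C a => simpa using hasFDerivAt_const a x
  | add p q hp hq =>
    simp only [map_add, add_smul, Finset.sum_add_distrib]
    exact hp.add hq
  | mul_X p i hp =>
    have h := hp.mul (hasFDerivAt_apply i x)
    simp only [map_mul, eval_X]
    refine h.congr_fderiv (ContinuousLinearMap.ext fun v => ?_)
    simp [pderiv_X, Pi.single_apply, add_mul,
      Finset.sum_add_distrib, Finset.mul_sum, mul_assoc, apply_ite]

end Iterate

end PolyDyn

namespace PolyDyn

open MvPolynomial

/-! ### The model map with components `2 x_i ^ D`. -/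

section Model

theorem natDegree_C_mul_X_pow_sub_X {c : ℝ} (hc : 2 ≤ c) (n : ℕ) :
    (Polynomial.C c * Polynomial.X ^ n - Polynomial.X).natDegree = max n 1 := by
  rcases lt_trichotomy n 1 with h | rfl | h
  · obtain rfl : n = 0 := by omega
    rw [Polynomial.natDegree_sub_eq_right_of_natDegree_lt] <;> simp
  · have : Polynomial.C c * Polynomial.X ^ 1 - Polynomial.X =
        Polynomial.C (c - 1) * (Polynomial.X : Polynomial ℝ) := by
      rw [Polynomial.C_sub, Polynomial.C_1]; ring
    rw [this, Polynomial.natDegree_C_mul_X _ (by linarith), max_self]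
  · have h1 : (Polynomial.C c * Polynomial.X ^ n : Polynomial ℝ).natDegree = n :=
      Polynomial.natDegree_C_mul_X_pow _ _ (by linarith)
    rw [Polynomial.natDegree_sub_eq_left_of_natDegree_lt, h1, max_eq_left h.le]
    rw [h1, Polynomial.natDegree_X]
    exact h

/-- At a root of `c X ^ n - X` the multiplier is `0` or `κ`, where `κ = n` for `n ≥ 2`. For `n = 1`
it is `c`, which is why the leading coefficient is kept at least `2`. -/
theorem exists_dvd_derivative_sq_sub {c : ℝ} (hc : 2 ≤ c) (n : ℕ) :
    ∃ κ : ℝ, κ ^ 2 ≠ 1 ∧ Polynomial.C c * Polynomial.X ^ n - Polynomial.X ∣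
      (Polynomial.C c * Polynomial.X ^ n).derivative ^ 2 -
        Polynomial.C κ * (Polynomial.C c * Polynomial.X ^ n).derivative := by
  rcases lt_trichotomy n 1 with h | rfl | h
  · obtain rfl : n = 0 := by omega
    exact ⟨0, by norm_num, by simp⟩
  · refine ⟨c, by nlinarith, ?_⟩
    simp [sq]
  · obtain ⟨l, rfl⟩ : ∃ l, n = l + 2 := ⟨n - 2, by omega⟩
    refine ⟨(l + 2 : ℕ), ?_, Polynomial.C (c * (l + 2 : ℕ) ^ 2) * Polynomial.X ^ l, ?_⟩
    · push_cast
      have : (0 : ℝ) ≤ l := l.cast_nonneg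
      nlinarith
    · rw [Polynomial.derivative_C_mul_X_pow]
      simp only [Polynomial.C_mul, Polynomial.C_pow,
        show l + 2 - 1 = l + 1 from rfl]
      ring

variable {τ : Type*}

theorem polyIter_two_mul_X_pow (D : ℕ) {k : ℕ} (hk : 0 < k) :
    ∃ c : ℝ, 2 ≤ c ∧ ∀ i : τ, polyIter (fun i => C (2 : ℝ) * X i ^ D) k i =
      Polynomial.aeval (X i) (Polynomial.C c * Polynomial.X ^ (D ^ k)) := by
  induction k, hk using Nat.le_induction with
  | base => exact ⟨2, le_rfl, fun i => by simp [polyIter, algebraMap_eq]⟩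
  | succ k hk ih =>
    obtain ⟨c, hc, h⟩ := ih
    refine ⟨c * 2 ^ D ^ k, ?_, fun i => ?_⟩
    · have : (1 : ℝ) ≤ 2 ^ D ^ k := one_le_pow₀ (by norm_num)
      nlinarith
    · simp only [polyIter, h, map_mul, map_pow, Polynomial.aeval_C, Polynomial.aeval_X,
        algebraMap_eq, bind₁_C_right, bind₁_X_right]
      ring

variable [Fintype τ] [DecidableEq τ]

theorem resonance_aeval_X (q : Polynomial ℝ) :
    resonance (fun i : τ => Polynomial.aeval (X i) q) =
      ∏ p : τ × τ, (1 - Polynomial.aeval (X p.1) q.derivative *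
        Polynomial.aeval (X p.2) q.derivative : MvPolynomial τ ℝ) := by
  have hJ : jacobian (fun i : τ => Polynomial.aeval (X i) q) =
      Matrix.diagonal fun i => (Polynomial.aeval (X i) q.derivative : MvPolynomial τ ℝ) := by
    ext1 i j
    rw [jacobian, Matrix.of_apply, Derivation.map_aeval, pderiv_X, Matrix.diagonal_apply]
    by_cases h : i = j
    · subst h; simp
    · simp [h]
  rw [resonance, hJ, Matrix.diagonal_kronecker_diagonal, ← Matrix.diagonal_one,
    Matrix.diagonal_sub, Matrix.det_diagonal]

/-- Modulo the equations, a product `t` of two multipliers satisfies `t ^ 2 = κ ^ 2 * t`. Hence each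
factor `1 - t` of the resonance is a unit, with inverse `1 - t / (κ ^ 2 - 1)`. -/
theorem one_mem_sup_span_resonance {q f : Polynomial ℝ} {κ : ℝ} (hκ : κ ^ 2 ≠ 1)
    (hdvd : f ∣ q.derivative ^ 2 - Polynomial.C κ * q.derivative) :
    1 ∈ Ideal.span (Set.range fun i : τ => (Polynomial.aeval (X i) f : MvPolynomial τ ℝ)) ⊔
      Ideal.span {resonance fun i : τ => (Polynomial.aeval (X i) q : MvPolynomial τ ℝ)} := by
  rw [← Ideal.eq_top_iff_one, resonance_aeval_X, ← Ideal.prod_span_singleton]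
  refine Ideal.sup_prod_eq_top fun p _ => (Ideal.eq_top_iff_one _).2 ?_
  set I := Ideal.span (Set.range fun i : τ => (Polynomial.aeval (X i) f : MvPolynomial τ ℝ))
  set e : τ → MvPolynomial τ ℝ := fun i => Polynomial.aeval (X i) q.derivative with he
  have hI (i : τ) : e i ^ 2 - C κ * e i ∈ I := by
    have h := map_dvd (Polynomial.aeval (X i : MvPolynomial τ ℝ)) hdvd
    rw [map_sub, map_pow, map_mul, Polynomial.aeval_C, algebraMap_eq] at h
    exact Ideal.mem_of_dvd _ h (Ideal.subset_span ⟨i, rfl⟩)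
  have hσ : C (κ ^ 2 - 1)⁻¹ * (C κ ^ 2 - 1) = (1 : MvPolynomial τ ℝ) := by
    rw [← C_pow, ← C_1, ← C_sub, ← C_mul, inv_mul_cancel₀ (sub_ne_zero.2 hκ)]
  set σ : MvPolynomial τ ℝ := C (κ ^ 2 - 1)⁻¹
  have key : (-σ * e p.2 ^ 2 * (e p.1 ^ 2 - C κ * e p.1) +
      -σ * C κ * e p.1 * (e p.2 ^ 2 - C κ * e p.2)) +
      (1 - σ * (e p.1 * e p.2)) * (1 - e p.1 * e p.2) = 1 := by
    linear_combination (e p.1 * e p.2) * hσ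
  have hmem := Submodule.add_mem (I ⊔ Ideal.span {1 - e p.1 * e p.2})
    (Ideal.mem_sup_left (add_mem (Ideal.mul_mem_left _ (-σ * e p.2 ^ 2) (hI p.1))
      (Ideal.mul_mem_left _ (-σ * C κ * e p.1) (hI p.2))))
    (Ideal.mem_sup_right (Ideal.mul_mem_left _ (1 - σ * (e p.1 * e p.2))
      (Ideal.mem_span_singleton_self _)))
  rwa [key] at hmem

end Model

/-! ### The universal family of polynomial maps and the generic conclusions. -/

section Family

variable {N D : ℕ}

/-- The polynomial map with indeterminate coefficients. -/
noncomputable def genericMap (N D : ℕ) (i : Fin N) :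
    MvPolynomial (Fin N) (MvPolynomial (multiIndices N D × Fin N) ℝ) :=
  ∑ α : multiIndices N D, C (X (α, i)) * ∏ j, X j ^ (α : Fin N → ℕ) j

/-- The coefficients of a polynomial map as a vector indexed by pairs. -/
def coeffs (N D : ℕ) : PolySpace N D →ₗ[ℝ] multiIndices N D × Fin N → ℝ where
  toFun a p := a p.1 p.2
  map_add' _ _ := rfl
  map_smul' _ _ := rfl

theorem coeffs_surjective : Function.Surjective (coeffs N D) :=
  fun b => ⟨fun α i => b (α, i), rfl⟩

theorem totalDegree_genericMap_le (i : Fin N) : (genericMap N D i).totalDegree ≤ D := by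
  refine totalDegree_finsetSum_le fun α _ => (totalDegree_mul _ _).trans ?_
  rw [totalDegree_C, zero_add]
  refine (totalDegree_finsetProd _ _).trans (le_trans ?_ (mem_multiIndices.1 α.2))
  exact Finset.sum_le_sum fun j _ => (totalDegree_X_pow _ _).le

theorem eval_map_genericMap (a : PolySpace N D) (x : Fin N → ℝ) (i : Fin N) :
    eval x (map (eval (coeffs N D a)) (genericMap N D i)) = polyMap a x i := by
  simp [genericMap, polyMap, coeffs]

theorem exists_map_genericMap_eq (N D : ℕ) : ∃ a₀ : multiIndices N D × Fin N → ℝ,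
    ∀ i, map (eval a₀) (genericMap N D i) = C 2 * X i ^ D := by
  classical
  refine ⟨fun p => if (p.1 : Fin N → ℕ) = Pi.single p.2 D then 2 else 0, fun i => ?_⟩
  rw [genericMap, map_sum, Finset.sum_eq_single
    ⟨Pi.single i D, mem_multiIndices.2 (by simp)⟩]
  · simp only [map_mul, map_C, eval_X, map_prod, map_pow, map_X, if_true]
    congr 1
    rw [Finset.prod_eq_single i] <;> simp +contextual
  · intro α _ hα
    rw [map_mul, map_C, eval_X, if_neg, C_0, zero_mul]
    exact fun h => hα (Subtype.ext h)
  · simp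

/-- The equations for the points of period `k` of the polynomial map with indeterminate
coefficients. -/
noncomputable def periodEq (N D k : ℕ) (i : Fin N) :
    MvPolynomial (Fin N) (MvPolynomial (multiIndices N D × Fin N) ℝ) :=
  polyIter (genericMap N D) k i - X i

theorem map_periodEq (k : ℕ) (b : multiIndices N D × Fin N → ℝ) (i : Fin N) :
    map (eval b) (periodEq N D k i) =
      polyIter (fun j => map (eval b) (genericMap N D j)) k i - X i := by
  rw [periodEq, map_sub, map_polyIter, map_X]

theorem eval_polyIter_genericMap (a : PolySpace N D) (k : ℕ) (x : Fin N → ℝ) :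
    (fun i => eval x (polyIter (fun j => map (eval (coeffs N D a)) (genericMap N D j)) k i)) =
      (polyMap a)^[k] x := by
  rw [eval_polyIter]
  congr 1
  funext y i
  exact eval_map_genericMap a y i

theorem eval_map_periodEq {a : PolySpace N D} {k : ℕ} {x : Fin N → ℝ}
    (hx : x ∈ periodicPts (polyMap a) k) (i : Fin N) :
    eval x (map (eval (coeffs N D a)) (periodEq N D k i)) = 0 := by
  have h := congrFun ((eval_polyIter_genericMap a k x).trans hx) i
  rw [map_periodEq, map_sub, h, eval_X, sub_self]

theorem exists_model (N D : ℕ) {k : ℕ} (hk : 0 < k) :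
    ∃ (a₀ : multiIndices N D × Fin N → ℝ) (f : Polynomial ℝ), f ≠ 0 ∧
      f.natDegree = max D 1 ^ k ∧ (∀ i, (periodEq N D k i).totalDegree ≤ f.natDegree) ∧
      (∀ i, map (eval a₀) (periodEq N D k i) = Polynomial.aeval (X i) f) ∧
      1 ∈ Ideal.span (Set.range fun i => map (eval a₀) (periodEq N D k i)) ⊔
        Ideal.span {map (eval a₀) (resonance (polyIter (genericMap N D) k))} := by
  obtain ⟨a₀, ha₀⟩ := exists_map_genericMap_eq N D
  obtain ⟨c, hc, hiter⟩ := polyIter_two_mul_X_pow (τ := Fin N) D hk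
  obtain ⟨κ, hκ, hdvd⟩ := exists_dvd_derivative_sq_sub hc (D ^ k)
  have hdeg := natDegree_C_mul_X_pow_sub_X hc (D ^ k)
  have hmax : max (D ^ k) 1 = max D 1 ^ k := by
    rcases Nat.eq_zero_or_pos D with rfl | hD
    · simp [hk.ne']
    · rw [max_eq_left (show 1 ≤ D from hD), max_eq_left (Nat.pow_pos hD)]
  have hP (i : Fin N) : polyIter (fun j => map (eval a₀) (genericMap N D j)) k i =
      Polynomial.aeval (X i) (Polynomial.C c * Polynomial.X ^ (D ^ k)) := by
    rw [← hiter]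
    simp only [ha₀]
  have hF (i : Fin N) : map (eval a₀) (periodEq N D k i) =
      Polynomial.aeval (X i) (Polynomial.C c * Polynomial.X ^ (D ^ k) - Polynomial.X) := by
    rw [map_periodEq, hP, map_sub, Polynomial.aeval_X]
  refine ⟨a₀, Polynomial.C c * Polynomial.X ^ (D ^ k) - Polynomial.X, ?_, hdeg.trans hmax, ?_,
    hF, ?_⟩
  · intro h0
    rw [h0, Polynomial.natDegree_zero] at hdeg
    have := le_max_right (D ^ k) 1
    omega
  · intro i
    rw [hdeg]
    refine (totalDegree_sub _ _).trans (max_le_max ?_ (totalDegree_X i).le)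
    exact totalDegree_polyIter_le totalDegree_genericMap_le k i
  · simp only [hF, map_resonance, map_polyIter, hP]
    exact one_mem_sup_span_resonance hκ hdvd

theorem hasFDerivAt_iterate (a : PolySpace N D) (k : ℕ) (x : Fin N → ℝ) :
    HasFDerivAt (polyMap a)^[k] (ContinuousLinearMap.pi fun i => ∑ j, eval x (pderiv j
      (polyIter (fun j => map (eval (coeffs N D a)) (genericMap N D j)) k i)) •
        ContinuousLinearMap.proj (R := ℝ) (φ := fun _ : Fin N => ℝ) j) x := by
  rw [← funext (eval_polyIter_genericMap a k)]
  exact hasFDerivAt_pi.2 fun i => hasFDerivAt_eval _ x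

theorem jacobianIterate_eq (a : PolySpace N D) (k : ℕ) (x : Fin N → ℝ) :
    jacobianIterate (polyMap a) k x = ((jacobian (polyIter (fun j =>
      map (eval (coeffs N D a)) (genericMap N D j)) k)).map (eval x)).map
        (fun r : ℝ => (r : ℂ)) := by
  rw [jacobianIterate, (hasFDerivAt_iterate a k x).fderiv]
  congr 1
  ext i j
  simp [LinearMap.toMatrix'_apply, jacobian, Pi.single_apply]

theorem ae_encard_periodicPts_le (N D : ℕ) {k : ℕ} (hk : 0 < k) :
    ∀ᵐ a : PolySpace N D ∂volume,
      (periodicPts (polyMap a) k).encard ≤ ((max D 1 ^ (N * k) : ℕ) : ℕ∞) := by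
  obtain ⟨a₀, f, hf, hd, hFd, hF, -⟩ := exists_model N D hk
  -- Spanning is needed in every degree `m`, hence one exceptional null set for each `m`.
  choose S hS hmem using fun m => exists_ne_zero_forall_mem_sup_reduced hf hFd hF m
  filter_upwards [ae_all_iff.2 fun m => ae_eval_ne_zero volume (coeffs N D) coeffs_surjective
    (hS m)] with a ha
  have h := encard_zeros_le (fun p => hmem p.totalDegree _ (ha _) p le_rfl)
    (Z := periodicPts (polyMap a) k) fun x hx p hp => ?_
  · rwa [hd, ← pow_mul, mul_comm k N] at h
  · have hle : Ideal.span (Set.range fun i =>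
        map (eval (coeffs N D a)) (periodEq N D k i)) ≤ RingHom.ker (eval x) := by
      rw [Ideal.span_le]
      rintro _ ⟨i, rfl⟩
      exact eval_map_periodEq hx i
    exact hle hp

theorem ae_isHyperbolicAt (N D : ℕ) {k : ℕ} (hk : 0 < k) :
    ∀ᵐ a : PolySpace N D ∂volume,
      ∀ x ∈ periodicPts (polyMap a) k, IsHyperbolicAt (polyMap a) k x := by
  obtain ⟨a₀, f, hf, -, hFd, hF, hone⟩ := exists_model N D hk
  obtain ⟨S, hS, hmem⟩ := exists_ne_zero_forall_one_mem hf hFd hF _ hone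
  filter_upwards [ae_eval_ne_zero volume (coeffs N D) coeffs_surjective hS] with a ha
  intro x hx
  refine ⟨(hasFDerivAt_iterate a k x).differentiableAt, fun z hz hz1 => ?_⟩
  rw [jacobianIterate_eq] at hz
  have hres := det_one_sub_kronecker_eq_zero hz1 hz
  rw [← ringHom_det_one_sub_kronecker, ← resonance] at hres
  -- At a non-hyperbolic periodic point all generators vanish, contradicting that they generate `1`.
  have hle : Ideal.span (Set.range fun i =>
      map (eval (coeffs N D a)) (periodEq N D k i)) ⊔
      Ideal.span {map (eval (coeffs N D a)) (resonance (polyIter (genericMap N D) k))} ≤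
      RingHom.ker (eval x) := by
    refine sup_le ?_ ?_
    · rw [Ideal.span_le]
      rintro _ ⟨i, rfl⟩
      exact eval_map_periodEq hx i
    · rw [Ideal.span_singleton_le_iff_mem, RingHom.mem_ker, map_resonance]
      simpa only [map_polyIter] using hres
  have := hle (hmem _ ha)
  simp at this

theorem growsAtMostExponentially_of_encard_le {X : Type*} [TopologicalSpace X] {f : X → X}
    {N d : ℕ} (hd : 1 ≤ d)
    (h : ∀ k : ℕ, 0 < k → (periodicPts f k).encard ≤ ((d ^ (N * k) : ℕ) : ℕ∞)) :
    GrowsAtMostExponentially f := by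
  have hd0 : (0 : ℝ) < d := by exact_mod_cast hd
  have hlog : 0 ≤ Real.log d := Real.log_nonneg (by exact_mod_cast hd)
  -- The `+ 1` keeps the constant positive when `N = 0` or `d = 1`.
  refine ⟨N * Real.log d + 1, by positivity, fun k hk => ?_⟩
  have h1 : numIsolated f k ≤ ((d ^ (N * k) : ℕ) : ℕ∞) :=
    (Set.encard_le_encard fun x hx => hx.1).trans (h k hk)
  calc ((numIsolated f k : ℕ∞) : ENNReal) ≤ (((d ^ (N * k) : ℕ) : ℕ∞) : ENNReal) := by
        exact_mod_cast h1
    _ = ENNReal.ofReal ((d : ℝ) ^ (N * k)) := by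
        rw [ENat.toENNReal_coe, ← Nat.cast_pow, ENNReal.ofReal_natCast]
    _ ≤ _ := by
        refine ENNReal.ofReal_le_ofReal ?_
        rw [← Real.exp_log (pow_pos hd0 _), Real.log_pow]
        refine Real.exp_le_exp.2 ?_
        push_cast
        have : (0 : ℝ) ≤ k := k.cast_nonneg
        nlinarith

end Family

end PolyDyn

theorem mainTheorem2 (N D : ℕ) :
    ∀ᵐ a : PolyDyn.PolySpace N D ∂(volume : Measure (PolyDyn.PolySpace N D)),
      PolyDyn.OnlyHyperbolicPeriodicOrbits (PolyDyn.polyMap a) ∧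
      (∀ k : ℕ, 0 < k →
        (PolyDyn.periodicPts (PolyDyn.polyMap a) k).encard ≤ (((max D 1) ^ (N * k) : ℕ) : ℕ∞)) ∧
      PolyDyn.GrowsAtMostExponentially (PolyDyn.polyMap a) := by
  filter_upwards [ae_all_iff.2 fun k => ae_all_iff.2 fun hk : 0 < k =>
      PolyDyn.ae_isHyperbolicAt N D hk,
    ae_all_iff.2 fun k => ae_all_iff.2 fun hk : 0 < k =>
      PolyDyn.ae_encard_periodicPts_le N D hk] with a h1 h2
  exact ⟨h1, h2, PolyDyn.growsAtMostExponentially_of_encard_le (le_max_right D 1) h2⟩
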